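/- Fix an integer $n\ge 1$ and identify $\mathbb{R}^n$ with the plane $\{x_{n+1}=1\}$ in $\mathbb{R}^{n+1}$; a vector with positive last coordinate is a set of projective coordinates for the point of $\mathbb{R}^n$ obtained by dividing by its last coordinate. Let $V$ be the $(n+1)\times(n+1)$ matrix whose entry in position $(i,j)$ is $1$ if $i=n+1$, or if $j\ge 2$ and $i+j\le n+2$, and $0$ otherwise. Let $A_0,A_1$ be the $(n+1)\times(n+1)$ matrices all of whose entries are $0$ except for $(A_0)_{1,1}=1$, $(A_1)_{2,1}=1$ and, in both matrices, the entries in positions $(1,n+1)$, $(2,n+1)$ and $(j+1,j)$ for $2\le j\le n$, which are $1$. For $a=0,1$ let $B_a$ be $A_a$ with the two $1$'s in the last column replaced by $1/2$. Let $\Delta$, $\Delta_0$, $\Delta_1$ be the simplices in $\mathbb{R}^n$ whose vertices have as projective coordinates the columns of $V$, $VA_0$, $VA_1$, respectively; then $\Delta=\Delta_0\cup\Delta_1$. The Mönkemeyer map $M:\Delta\to\Delta$ is given on $\Delta_a$ by the fractional-linear map with matrix $VA_a^{-1}V^{-1}$ in projective coordinates, and the tent map $T:\Delta\to\Delta$ is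 given on $\Delta_a$ by the affine map with matrix $VB_a^{-1}V^{-1}$. For a finite word over $\{0,1\}$ define recursively $\Delta_{a_0\ldots a_{t-1}}=\Delta_{a_0}\cap M^{-1}\Delta_{a_1\ldots a_{t-1}}$ and $\Gamma_{a_0\ldots a_{t-1}}=\Delta_{a_0}\cap T^{-1}\Gamma_{a_1\ldots a_{t-1}}$, where both cells of the empty word are $\Delta$ (so that $\Gamma_a=\Delta_a$). For $\bar a=a_0a_1a_2\ldots\in\{0,1\}^{\mathbb{N}}$ and $t\ge 0$ write $\bar a\restriction t=a_0\ldots a_{t-1}$. **Lemma.** For every $\bar a\in\{0,1\}^{\mathbb{N}}$, the intersection $\bigcap_{t\ge 0}\Delta_{\bar a\restriction t}$ is a singleton, and the intersection $\bigcap_{t\ge 0}\Gamma_{\bar a\restriction t}$ is a singleton as well. Moreover, every product of $(n+1)n/2$ matrices from $\{B_0,B_1\}$ (repetitions allowed) is scrambling, that is, it is a column-stochastic matrix $C$ such that for any two column indices $j_1,j_2$ there is a row index $i$ with $C_{ij_1}>0$ and $C_{ij_2}>0$. -/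

import Mathlib

namespace Monkemeyer

open Matrix

noncomputable section

/-- The `(n+1) × (n+1)` matrix whose columns are the primitive projective coordinates of the
vertices of the base simplex. Indices run from `0` to `n`: the entry in position `(i, j)` is `1` if
`i = n`, or if `1 ≤ j` and `i + j ≤ n`; it is `0` otherwise. -/
def matV (n : ℕ) : Matrix (Fin (n + 1)) (Fin (n + 1)) ℝ :=
  Matrix.of fun i j =>
    if i.val = n ∨ (1 ≤ j.val ∧ i.val + j.val ≤ n) then 1 else 0

/-- The matrices `A₀`, `A₁` (indices run from `0` to `n`). The entries equal to `1` are those in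
position `(a, 0)`, `(0, n)`, `(1, n)`, and `(j + 1, j)` for `1 ≤ j ≤ n - 1`. -/
def matA (n : ℕ) (a : Fin 2) : Matrix (Fin (n + 1)) (Fin (n + 1)) ℝ :=
  Matrix.of fun i j =>
    if (j.val = 0 ∧ i.val = a.val) ∨ (j.val = n ∧ (i.val = 0 ∨ i.val = 1)) ∨
      (1 ≤ j.val ∧ i.val = j.val + 1) then 1 else 0

/-- The matrices `B₀`, `B₁`: as `A₀`, `A₁`, with the two `1`s of the last column replaced
by `1/2`. -/
def matB (n : ℕ) (a : Fin 2) : Matrix (Fin (n + 1)) (Fin (n + 1)) ℝ :=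
  Matrix.of fun i j => if j.val = n then matA n a i j / 2 else matA n a i j

/-- The identification of `ℝⁿ` with the plane `{x_{n+1} = 1}` of `ℝⁿ⁺¹`. -/
def lift {n : ℕ} (x : Fin n → ℝ) : Fin (n + 1) → ℝ :=
  Fin.snoc (α := fun _ => ℝ) x 1

/-- Projection of a point of `ℝⁿ⁺¹` (with positive last coordinate) to the plane
`{x_{n+1} = 1}`, identified with `ℝⁿ`. -/
def proj {n : ℕ} (v : Fin (n + 1) → ℝ) : Fin n → ℝ :=
  fun i => v i.castSucc / v (Fin.last n)

/-- The simplex in `ℝⁿ` whose vertices have the columns of `W` as projective coordinates. -/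
def simplexOf {n : ℕ} (W : Matrix (Fin (n + 1)) (Fin (n + 1)) ℝ) : Set (Fin n → ℝ) :=
  convexHull ℝ (Set.range fun j => proj (W.col j))

/-- The base simplex `Δ`. -/
def baseSimplex (n : ℕ) : Set (Fin n → ℝ) :=
  simplexOf (matV n)

/-- The two halves `Δ₀`, `Δ₁` of the base simplex. -/
def half (n : ℕ) (a : Fin 2) : Set (Fin n → ℝ) :=
  simplexOf (matV n * matA n a)

/-- The fractional-linear map `M_a : Δ_a → Δ` with matrix `V A_a⁻¹ V⁻¹`. -/
def monkemeyerBranch (n : ℕ) (a : Fin 2) (x : Fin n → ℝ) : Fin n → ℝ :=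
  proj ((matV n * (matA n a)⁻¹ * (matV n)⁻¹) *ᵥ lift x)

/-- The affine map `T_a : Δ_a → Δ` with matrix `V B_a⁻¹ V⁻¹` (whose last row is `(0 … 0 1)`). -/
def tentBranch (n : ℕ) (a : Fin 2) (x : Fin n → ℝ) : Fin n → ℝ :=
  fun i => ((matV n * (matB n a)⁻¹ * (matV n)⁻¹) *ᵥ lift x) i.castSucc

open Classical in
/-- The Mönkemeyer map: `M_0` on `Δ₀` and `M_1` on `Δ₁` (the two branches agree on `Δ₀ ∩ Δ₁`).
Values outside `Δ = Δ₀ ∪ Δ₁` are never used. -/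
def monkemeyerMap (n : ℕ) (x : Fin n → ℝ) : Fin n → ℝ :=
  if x ∈ half n 0 then monkemeyerBranch n 0 x else monkemeyerBranch n 1 x

open Classical in
/-- The tent map: `T_0` on `Δ₀` and `T_1` on `Δ₁` (the two branches agree on `Δ₀ ∩ Δ₁`).
Values outside `Δ = Δ₀ ∪ Δ₁` are never used. -/
def tentMap (n : ℕ) (x : Fin n → ℝ) : Fin n → ℝ :=
  if x ∈ half n 0 then tentBranch n 0 x else tentBranch n 1 x

/-- The cells of the time-`t` partitions for a map `f` of `Δ`: the empty word gives `Δ`, and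
the word `a₀ a₁ … a_{t-1}` gives `Δ_{a₀} ∩ f⁻¹ (cell of a₁ … a_{t-1})`. When `f` maps `Δ` to
itself, the cell of a one-letter word `a` is thus `Δ_a`. -/
def cell (n : ℕ) (f : (Fin n → ℝ) → (Fin n → ℝ)) : List (Fin 2) → Set (Fin n → ℝ)
  | [] => baseSimplex n
  | a :: w => half n a ∩ f ⁻¹' cell n f w

/-- The Mönkemeyer simplexes `Δ_{a₀ … a_{t-1}}`. -/
def monkemeyerSimplex (n : ℕ) (w : List (Fin 2)) : Set (Fin n → ℝ) :=
  cell n (monkemeyerMap n) w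

/-- The tent simplexes `Γ_{a₀ … a_{t-1}}`. -/
def tentSimplex (n : ℕ) (w : List (Fin 2)) : Set (Fin n → ℝ) :=
  cell n (tentMap n) w

/-- The initial segment `a₀ a₁ … a_{t-1}` of an infinite sequence. -/
def initialWord (a : ℕ → Fin 2) (t : ℕ) : List (Fin 2) :=
  List.ofFn fun i : Fin t => a i

/-- A column-stochastic matrix is scrambling if for any two columns there is a row in which both
columns have a positive entry. -/
def IsScrambling {m : ℕ} (C : Matrix (Fin m) (Fin m) ℝ) : Prop :=
  C ∈ Matrix.colStochastic ℝ (Fin m) ∧ ∀ j₁ j₂, ∃ i, 0 < C i j₁ ∧ 0 < C i j₂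

end

end Monkemeyer

/-!
A simplex with ordered vertices is thought of as a pivot `p` followed by a queue `q₁, …, qₙ`.
Multiplying its matrix of projective coordinates by `A_a` or `B_a` moves the front `q₁` to the
back of the queue, replacing it there by `p + q₁` or `(p + q₁) / 2`; the new pivot is `p` if `a = 0`
and `q₁` if `a = 1`. Each cell is the simplex obtained in this way along its word
(`cell_eq_coneSet`), because both maps undo one such step. The cells along a sequence are therefore
nested nonempty compact sets, and what matters is that they shrink to a point. This is measured by
the oscillation of the ratios `r j / d j`, where `d` is the row of denominators of the vertices and
`r` is one of the rows of their projective coordinates.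

*Scrambling.* The entries of a product of matrices describe tokens that move with the letters: from
`0` to the letter `a`, from `j` to `j + 1`, and from `n` to `0` or `1` at will. Two columns of a
product share a positive row if two tokens starting there can be brought together. The control
comes from the choice at `n`: if the gap between the tokens is `g`, returning to `1` turns it into
`n - g`, and returning to `0` into at least `n - g + 1`. Alternating the two, one can make the
gap either grow up to `n` or shrink down to `1`, after which the tokens meet; doing whichever is
quicker takes at most `(n + 1) * n / 2` moves in all (`forced_of_le`).

*Contraction.* If all denominators differ by a factor at most `2`, the next `(n + 1) * n / 2`
steps take averages in which any two vertices share a weight bounded below in terms of `n` only, so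
oscillation shrinks by a definite factor (`Osc.rowAt_add_block`). For the tent map all denominators
are `1` throughout. For the Mönkemeyer map the denominators increase along the list
`p, q₁, …, qₙ`, and the last is at most the sum of the first two (`denominators_monotone`): thus
they are balanced right after each letter `1`, when the pivot is taken from the queue
(`balanced_denominators`). If the letter `1` occurs only finitely often, the pivot is eventually
fixed and is added again and again to all the other vertices, which converge to it
(`exists_osc_le_of_eventually_zero`).
-/

namespace Monkemeyer

open Matrix

/-! ### Two tokens driven by a word -/

/-- A token in place `i` may move to place `k ≤ n` under the letter `a` precisely when the entry
in position `(k, i)` of `matA n a` is nonzero. Places are natural numbers, to keep the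
arithmetic of the token game free of coercions. -/
def Step (n : ℕ) (a : Fin 2) (i k : ℕ) : Prop :=
  k ≤ n ∧ ((i = 0 ∧ k = a.val) ∨ (i = n ∧ (k = 0 ∨ k = 1)) ∨ (1 ≤ i ∧ k = i + 1))

/-- A token can be led from `i` to `k` by the successive letters of a word. -/
def Reach (n : ℕ) : List (Fin 2) → ℕ → ℕ → Prop
  | [], i, k => i = k
  | a :: w, i, k => ∃ i', Step n a i i' ∧ Reach n w i' k

/-- Whatever the word of length at least `T`, tokens starting at `i` and `j` can be led by it
to a common place. -/
def Forced (n T i j : ℕ) : Prop :=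
  ∀ w : List (Fin 2), T ≤ w.length → ∃ k, Reach n w i k ∧ Reach n w j k

lemma Forced.mono {n T T' i j : ℕ} (h : Forced n T i j) (hT : T ≤ T') : Forced n T' i j :=
  fun w hw => h w (hT.trans hw)

lemma Forced.symm {n T i j : ℕ} (h : Forced n T i j) : Forced n T j i :=
  fun w hw => (h w hw).imp fun _ hk => ⟨hk.2, hk.1⟩

lemma exists_step {n : ℕ} (hn : 1 ≤ n) (a : Fin 2) {i : ℕ} (hi : i ≤ n) : ∃ k, Step n a i k := by
  have := a.isLt
  rcases Nat.eq_zero_or_pos i with h | h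
  · exact ⟨a.val, by omega, Or.inl ⟨h, rfl⟩⟩
  · rcases hi.eq_or_lt with h' | h'
    · exact ⟨0, by omega, Or.inr (Or.inl ⟨h', Or.inl rfl⟩)⟩
    · exact ⟨i + 1, by omega, Or.inr (Or.inr ⟨h, rfl⟩)⟩

lemma exists_reach {n : ℕ} (hn : 1 ≤ n) (w : List (Fin 2)) :
    ∀ {i : ℕ}, i ≤ n → ∃ k, Reach n w i k := by
  induction w with
  | nil => exact fun {i} _ => ⟨i, rfl⟩
  | cons a w ih =>
    intro i hi
    obtain ⟨i', hi'⟩ := exists_step hn a hi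
    obtain ⟨k, hk⟩ := ih hi'.1
    exact ⟨k, i', hi', hk⟩

lemma forced_self {n : ℕ} (hn : 1 ≤ n) {i : ℕ} (hi : i ≤ n) : Forced n 0 i i :=
  fun w _ => (exists_reach hn w hi).imp fun _ hk => ⟨hk, hk⟩

lemma Forced.of_step {n T i j : ℕ}
    (h : ∀ a, ∃ i' j', Step n a i i' ∧ Step n a j j' ∧ Forced n T i' j') :
    Forced n (T + 1) i j := by
  rintro (_ | ⟨a, w⟩) hw
  · simp at hw
  · obtain ⟨i', j', hi, hj, hf⟩ := h a
    obtain ⟨k, hk, hk'⟩ := hf w (by simpa using hw)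
    exact ⟨k, ⟨i', hi, hk⟩, ⟨j', hj, hk'⟩⟩

lemma forced_zero_last {n : ℕ} (hn : 1 ≤ n) : Forced n 1 0 n := by
  refine Forced.of_step (T := 0) fun a => ?_
  have := a.isLt
  exact ⟨a.val, a.val, ⟨by omega, Or.inl ⟨rfl, rfl⟩⟩,
    ⟨by omega, Or.inr (Or.inl ⟨rfl, by omega⟩)⟩, forced_self hn (by omega)⟩

lemma Forced.advance {n T i j : ℕ} (d : ℕ) (hi : 1 ≤ i) (hj : 1 ≤ j) (hin : i + d ≤ n)
    (hjn : j + d ≤ n) (h : Forced n T (i + d) (j + d)) : Forced n (T + d) i j := by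
  induction d generalizing i j with
  | zero => exact h
  | succ d ih =>
    refine Forced.of_step fun a => ⟨i + 1, j + 1, ⟨by omega, by omega⟩, ⟨by omega, by omega⟩, ?_⟩
    exact ih (by omega) (by omega) (by omega) (by omega)
      (by convert h using 1 <;> omega)

/-- The token in the last place may choose to return to `0` or to `1`. -/
lemma Forced.wrap {n T i : ℕ} (c : ℕ) (hc : c = 0 ∨ c = 1) (hi : 1 ≤ i) (hin : i < n)
    (h : Forced n T c (i + 1)) : Forced n (T + 1) i n :=
  Forced.of_step fun _ => ⟨i + 1, c, ⟨by omega, by omega⟩, ⟨by omega, by omega⟩, h.symm⟩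

/-- A token in place `0` waits there as long as the word dictates, while the other one advances to
the last place; so the gap between the tokens is at least `k` on arrival. -/
lemma Forced.wait {n T k : ℕ} (hk : 1 ≤ k) (hkn : k ≤ n)
    (h : ∀ g, k ≤ g → g ≤ n → Forced n T (n - g) n) : Forced n (T + (n - k)) 0 k := by
  obtain ⟨m, hm⟩ : ∃ m, n - k = m := ⟨_, rfl⟩
  induction m generalizing k with
  | zero =>
    obtain rfl : k = n := by omega
    simpa using h k le_rfl le_rfl
  | succ m ih =>
    rw [hm, ← Nat.add_assoc]
    refine Forced.of_step fun a => ?_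
    have ha := a.isLt
    refine ⟨a.val, k + 1, ⟨by omega, Or.inl ⟨rfl, rfl⟩⟩, ⟨by omega, by omega⟩, ?_⟩
    have ha : a.val = 0 ∨ a.val = 1 := by omega
    rcases ha with ha | ha <;> rw [ha]
    · convert ih (k := k + 1) (by omega) (by omega) (fun g hg => h g (by omega)) (by omega)
        using 1
      omega
    · refine Forced.advance m le_rfl (by omega) (by omega) (by omega) ?_
      convert h k le_rfl hkn using 1 <;> omega

/-- From gap `g`, returning to `1` reverses the gap to `n - g` after `g` moves. -/
lemma Forced.reverse {n T g : ℕ} (hg : 1 ≤ g) (hgn : g < n) (h : Forced n T g n) :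
    Forced n (T + g) (n - g) n := by
  obtain ⟨d, rfl⟩ : ∃ d, g = d + 1 := ⟨g - 1, by omega⟩
  rw [← Nat.add_assoc]
  refine Forced.wrap 1 (Or.inr rfl) (by omega) (by omega) ?_
  refine Forced.advance d le_rfl (by omega) (by omega) (by omega) ?_
  convert h using 1 <;> omega

/-- From gap `g`, returning to `0` produces a gap at least `n - g + 1` after `g` moves. -/
lemma Forced.reverse_wait {n T g : ℕ} (hg : 1 ≤ g) (hgn : g < n)
    (h : ∀ g', n - g + 1 ≤ g' → g' ≤ n → Forced n T (n - g') n) :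
    Forced n (T + g) (n - g) n := by
  obtain ⟨d, rfl⟩ : ∃ d, g = d + 1 := ⟨g - 1, by omega⟩
  rw [← Nat.add_assoc]
  refine Forced.wrap 0 (Or.inl rfl) (by omega) (by omega) ?_
  convert Forced.wait (k := n - (d + 1) + 1) (by omega) (by omega) h using 1
  omega

/-- Returning alternately to `1` and to `0`, the gap grows by at least one every `n` moves,
until it is `n`. -/
lemma forced_of_gap_grow {n : ℕ} (hn : 1 ≤ n) (m : ℕ) :
    ∀ g, 1 ≤ g → g ≤ n → n - g ≤ m → Forced n (m * n + 1) (n - g) n := by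
  induction m with
  | zero =>
    intro g _ _ _
    obtain rfl : g = n := by omega
    simpa using forced_zero_last hn
  | succ m ih =>
    intro g hg hgn hm
    rcases hgn.eq_or_lt with rfl | hlt
    · rw [Nat.sub_self]
      exact (forced_zero_last hn).mono (by omega)
    · have h := Forced.reverse_wait (n := n) (T := m * n + 1) (g := n - g) (by omega) (by omega)
        (fun g' h1 h2 => ih g' (by omega) h2 (by omega))
      rw [Nat.sub_sub_self hgn] at h
      refine (Forced.reverse hg hlt h).mono ?_
      rw [Nat.add_mul]
      omega

/-- Returning alternately to `0` and to `1`, the gap shrinks by at least one every `n + 1` moves;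
when it is `1`, returning to `0` leads to a meeting. -/
lemma forced_of_gap_shrink {n : ℕ} (hn : 1 ≤ n) (m : ℕ) (hm : m + 1 < n) :
    Forced n (m * (n + 1) + 2) (n - (m + 1)) n := by
  induction m using Nat.strong_induction_on with
  | _ m ih =>
    rcases Nat.eq_zero_or_pos m with rfl | hpos
    · have h := Forced.reverse_wait (n := n) (T := 1) (g := 1) le_rfl hm fun g' h1 h2 => by
        obtain rfl : g' = n := by omega
        simpa using forced_zero_last hn
      simpa using h
    obtain ⟨m, rfl⟩ : ∃ m', m = m' + 1 := ⟨m - 1, by omega⟩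
    have h := Forced.reverse_wait (n := n) (T := m * n + n + 1) (g := m + 2) (by omega) hm ?_
    · refine h.mono ?_
      rw [Nat.add_mul, Nat.mul_add]
      omega
    intro g' h1 h2
    rcases h2.eq_or_lt with rfl | hlt
    · rw [Nat.sub_self]
      exact (forced_zero_last hn).mono (by omega)
    -- The new gap `g'` is reversed to `e + 1 ≤ m + 1`; a smaller `e` costs more moves
    -- in the reversal, but saves `n + 1` moves for each unit.
    obtain ⟨e, he⟩ : ∃ e, n - g' = e + 1 := ⟨n - g' - 1, by omega⟩
    have h' := ih e (by omega) (by omega)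
    rw [← he, Nat.sub_sub_self h2] at h'
    refine (Forced.reverse (by omega) hlt h').mono ?_
    have : e * n ≤ m * n := Nat.mul_le_mul_right n (by omega)
    rw [Nat.mul_add]
    omega

/-- With the token ahead in the last place, a large gap is made to grow and a small one to
shrink; both need at most `(n + 1) * n / 2 - (n - 1)` moves. -/
lemma forced_of_gap {n : ℕ} (hn : 1 ≤ n) {g : ℕ} (hg : 1 ≤ g) (hgn : g ≤ n) :
    Forced n ((n + 1) * n / 2 - (n - 1)) (n - g) n := by
  by_cases hbig : n + 1 ≤ 2 * g
  · refine (forced_of_gap_grow hn (n - g) g hg hgn le_rfl).mono ?_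
    have h1 : 2 * ((n - g) * n) ≤ (n - 1) * n := by
      rw [← Nat.mul_assoc]
      exact Nat.mul_le_mul_right n (by omega)
    have h2 : (n - 1) * n + 2 * n = (n + 1) * n := by
      rw [← Nat.add_mul]
      congr 1
      omega
    omega
  · obtain ⟨m, rfl⟩ : ∃ m, g = m + 1 := ⟨g - 1, by omega⟩
    refine (forced_of_gap_shrink hn m (by omega)).mono ?_
    have h1 : 2 * ((m + 1) * (n + 1)) ≤ n * (n + 1) := by
      rw [← Nat.mul_assoc]
      exact Nat.mul_le_mul_right _ (by omega)
    rw [Nat.add_mul, Nat.mul_comm n] at h1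
    omega

theorem forced_of_lt {n : ℕ} (hn : 1 ≤ n) {i j : ℕ} (hij : i < j) (hj : j ≤ n) :
    Forced n ((n + 1) * n / 2) i j := by
  have hN : n - 1 ≤ (n + 1) * n / 2 := by
    rw [Nat.le_div_iff_mul_le two_pos]
    calc (n - 1) * 2 ≤ n * (n + 1) := Nat.mul_le_mul (by omega) (by omega)
      _ = (n + 1) * n := Nat.mul_comm _ _
  rcases Nat.eq_zero_or_pos i with rfl | hi
  · refine (Forced.wait hij hj fun g hg hgn => forced_of_gap hn (by omega) hgn).mono ?_
    omega
  · have h := forced_of_gap hn (g := j - i) (by omega) (by omega)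
    refine (Forced.advance (T := (n + 1) * n / 2 - (n - 1)) (n - j) hi (by omega) (by omega)
      (by omega) ?_).mono (show _ ≤ _ by omega)
    convert h using 1 <;> omega

theorem forced_of_le {n : ℕ} (hn : 1 ≤ n) {i j : ℕ} (hi : i ≤ n) (hj : j ≤ n) :
    Forced n ((n + 1) * n / 2) i j := by
  rcases lt_trichotomy i j with h | rfl | h
  · exact forced_of_lt hn h hj
  · exact (forced_self hn hi).mono (Nat.zero_le _)
  · exact (forced_of_lt hn h hi).symm

/-! ### The matrices of the two maps -/

/-- The matrix `matA n a` with its last column multiplied by `s`. The values `s = 1` and `s = 1/2`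
give the matrices `A_a` and `B_a`; the parameter allows both maps to be treated at once. -/
def matC (n : ℕ) (s : ℝ) (a : Fin 2) : Matrix (Fin (n + 1)) (Fin (n + 1)) ℝ :=
  Matrix.of fun i j => if j.val = n then s * matA n a i j else matA n a i j

lemma matC_one (n : ℕ) : matC n 1 = matA n := by
  ext a i j
  simp [matC]

lemma matC_half (n : ℕ) : matC n (1 / 2) = matB n := by
  ext a i j
  simp only [matC, matB, of_apply]
  split_ifs <;> ring

variable {n : ℕ} {s : ℝ}

lemma matC_nonneg (hs : 0 ≤ s) (a : Fin 2) (i j) : 0 ≤ matC n s a i j := by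
  simp only [matC, matA, of_apply]
  split_ifs <;> simp [hs]

lemma matC_ge_half (hs : 1 / 2 ≤ s) {a : Fin 2} {i j : Fin (n + 1)}
    (h : Step n a j.val i.val) : 1 / 2 ≤ matC n s a i j := by
  have h' : (j.val = 0 ∧ i.val = a.val) ∨ (j.val = n ∧ (i.val = 0 ∨ i.val = 1)) ∨
      (1 ≤ j.val ∧ i.val = j.val + 1) := h.2
  simp only [matC, matA, of_apply, if_pos h']
  split_ifs <;> linarith

lemma prod_matC_nonneg (hs : 0 ≤ s) (w : List (Fin 2)) (i j) :
    0 ≤ (w.map (matC n s)).prod i j := by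
  induction w generalizing i j with
  | nil =>
    simp only [List.map_nil, List.prod_nil, one_apply]
    split_ifs <;> norm_num
  | cons a w ih =>
    rw [List.map_cons, List.prod_cons, mul_apply]
    exact Finset.sum_nonneg fun k _ => mul_nonneg (matC_nonneg hs a i k) (ih k j)

/-- Tokens travel along the columns of a product, so they read its factors from right to left. -/
lemma prod_matC_ge_of_reach (hs : 1 / 2 ≤ s) (w : List (Fin 2)) {i k : Fin (n + 1)}
    (h : Reach n w i.val k.val) :
    (1 / 2) ^ w.length ≤ (w.reverse.map (matC n s)).prod k i := by
  induction w generalizing i with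
  | nil =>
    obtain rfl : i = k := Fin.ext h
    simp
  | cons a w ih =>
    obtain ⟨i', hi', hr⟩ := h
    have h1 := ih (i := ⟨i', by have := hi'.1; omega⟩) hr
    have h2 := matC_ge_half hs (i := ⟨i', by have := hi'.1; omega⟩) (j := i) hi'
    rw [List.reverse_cons, List.map_append, List.prod_append, List.map_singleton,
      List.prod_singleton, mul_apply, List.length_cons, pow_succ]
    refine (mul_le_mul h1 h2 (by norm_num) ((by positivity : (0 : ℝ) ≤ _).trans h1)).trans ?_
    exact Finset.single_le_sum (f := fun x => (w.reverse.map (matC n s)).prod k x *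
      matC n s a x i) (fun x _ => mul_nonneg (prod_matC_nonneg (by linarith) _ _ _)
      (matC_nonneg (by linarith) _ _ _)) (Finset.mem_univ _)

lemma Reach.le {w : List (Fin 2)} {i k : ℕ} (hi : i ≤ n) (h : Reach n w i k) : k ≤ n := by
  induction w generalizing i with
  | nil => exact h ▸ hi
  | cons a w ih =>
    obtain ⟨i', hi', hr⟩ := h
    exact ih hi'.1 hr

/-- Any two columns of a product of `(n + 1) * n / 2` matrices are bounded below in a common
row. -/
theorem exists_common_row (hn : 1 ≤ n) (hs : 1 / 2 ≤ s) (w : List (Fin 2))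
    (hw : w.length = (n + 1) * n / 2) (j₁ j₂ : Fin (n + 1)) :
    ∃ k, (1 / 2) ^ ((n + 1) * n / 2) ≤ (w.map (matC n s)).prod k j₁ ∧
      (1 / 2) ^ ((n + 1) * n / 2) ≤ (w.map (matC n s)).prod k j₂ := by
  obtain ⟨k, h1, h2⟩ := forced_of_le hn (i := j₁) (j := j₂) (by omega) (by omega) w.reverse
    (by rw [List.length_reverse, hw])
  have hk : k ≤ n := Reach.le (by omega) h1
  refine ⟨⟨k, by omega⟩, ?_, ?_⟩
  · simpa [hw] using prod_matC_ge_of_reach hs w.reverse (k := ⟨k, by omega⟩) h1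
  · simpa [hw] using prod_matC_ge_of_reach hs w.reverse (k := ⟨k, by omega⟩) h2

/-! ### Action on row vectors -/

lemma vecMul_matC_zero (hn : 1 ≤ n) (d : Fin (n + 1) → ℝ) (a : Fin 2) :
    (d ᵥ* matC n s a) 0 = d ⟨a, by omega⟩ := by
  rw [vecMul, dotProduct, Finset.sum_eq_single (⟨a, by omega⟩ : Fin (n + 1))]
  · have : ¬ (0 = n) := by omega
    simp [matC, matA, this]
  · intro i _ hi
    have h1 : ¬ (0 = n) := by omega
    have h2 : ¬ (i.val = a.val) := fun h => hi (Fin.ext h)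
    simp [matC, matA, h1, h2]
  · simp

lemma vecMul_matC_of_lt (d : Fin (n + 1) → ℝ) (a : Fin 2) {j : Fin (n + 1)}
    (h0 : 1 ≤ j.val) (hj : j.val < n) :
    (d ᵥ* matC n s a) j = d ⟨j + 1, by omega⟩ := by
  rw [vecMul, dotProduct, Finset.sum_eq_single (⟨j + 1, by omega⟩ : Fin (n + 1))]
  · simp [matC, matA, hj.ne, h0]
  · intro i _ hi
    have h1 : ¬ (j.val = 0) := by omega
    have h2 : ¬ (i.val = j.val + 1) := fun h => hi (Fin.ext h)
    simp only [matC, matA, of_apply, hj.ne, h1, h2]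
    simp
  · simp

lemma vecMul_matC_last (hn : 1 ≤ n) (d : Fin (n + 1) → ℝ) (a : Fin 2) :
    (d ᵥ* matC n s a) (Fin.last n) = s * (d 0 + d ⟨1, by omega⟩) := by
  have hn0 : n ≠ 0 := by omega
  rw [vecMul, dotProduct, Finset.sum_eq_add (0 : Fin (n + 1)) ⟨1, by omega⟩]
  · simp [matC, matA]
    ring
  · simp [Fin.ext_iff]
  · intro i _ hi
    have h1 : ¬ (i.val = 1) := fun h => hi.2 (Fin.ext h)
    have h2 : ¬ (i.val = n + 1) := by omega
    simp [matC, matA, hi.1, h1, h2, hn0]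
  · simp
  · simp

lemma eq_zero_or_mid_or_last (j : Fin (n + 1)) :
    j = 0 ∨ (1 ≤ j.val ∧ j.val < n) ∨ j = Fin.last n := by
  rw [Fin.ext_iff, Fin.ext_iff, Fin.val_last, Fin.val_zero]
  omega

/-- Every entry of `d ᵥ* matC n s a` is an entry of `d`, or the one in the last place. -/
lemma vecMul_matC_cases (hn : 1 ≤ n) (P : ℝ → Prop) {d : Fin (n + 1) → ℝ}
    (a : Fin 2) (h : ∀ i, P (d i)) (hlast : P (s * (d 0 + d ⟨1, by omega⟩))) (j) :
    P ((d ᵥ* matC n s a) j) := by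
  rcases eq_zero_or_mid_or_last j with rfl | ⟨h0, hj⟩ | rfl
  · rw [vecMul_matC_zero hn]; exact h _
  · rw [vecMul_matC_of_lt d a h0 hj]; exact h _
  · rw [vecMul_matC_last hn]; exact hlast

lemma one_vecMul_matB (hn : 1 ≤ n) (a : Fin 2) : (1 : Fin (n + 1) → ℝ) ᵥ* matB n a = 1 := by
  rw [← matC_half]
  ext j
  exact vecMul_matC_cases hn (· = 1) a (fun _ => rfl) (by norm_num) j

lemma one_vecMul_prod_matB (hn : 1 ≤ n) (w : List (Fin 2)) :
    (1 : Fin (n + 1) → ℝ) ᵥ* (w.map (matB n)).prod = 1 := by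
  induction w with
  | nil => simp
  | cons a w ih => rw [List.map_cons, List.prod_cons, ← vecMul_vecMul, one_vecMul_matB hn, ih]

theorem isScrambling_prod_matB (hn : 1 ≤ n) (w : List (Fin 2))
    (hw : w.length = (n + 1) * n / 2) : IsScrambling (w.map (matB n)).prod := by
  refine ⟨⟨fun i j => ?_, one_vecMul_prod_matB hn w⟩, fun j₁ j₂ => ?_⟩
  · rw [← matC_half]
    exact prod_matC_nonneg (by norm_num) w i j
  · rw [← matC_half]
    obtain ⟨k, h1, h2⟩ := exists_common_row hn le_rfl w hw j₁ j₂
    exact ⟨k, lt_of_lt_of_le (by positivity) h1, lt_of_lt_of_le (by positivity) h2⟩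

/-! ### Oscillation of a row relative to a positive row -/

/-- The ratios of the entries of `r` to those of `d` differ by at most `D`. -/
def Osc {ι : Type*} (d r : ι → ℝ) (D : ℝ) : Prop :=
  ∀ j k, r j / d j - r k / d k ≤ D

lemma exists_osc {ι : Type*} [Finite ι] [Nonempty ι] (d r : ι → ℝ) : ∃ D, Osc d r D := by
  obtain ⟨iM, hM⟩ := Finite.exists_max fun i => r i / d i
  obtain ⟨im, hm⟩ := Finite.exists_min fun i => r i / d i
  exact ⟨r iM / d iM - r im / d im, fun j k => sub_le_sub (hM j) (hm k)⟩

/-- The ratio of `r ᵥ* Q` to `d ᵥ* Q` in position `j` is an average of the ratios of `r` to `d`;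
if the index `i` has weight at least `δ` in it, the average is at most the corresponding combination
of an upper bound `M` and the ratio at `i`. -/
lemma vecMul_div_vecMul_le {ι : Type*} [Fintype ι] {d r : ι → ℝ} {Q : Matrix ι ι ℝ} {δ M : ℝ}
    (hd : ∀ i, 0 < d i) (hQ : ∀ i j, 0 ≤ Q i j) {i j : ι} (hd' : 0 < (d ᵥ* Q) j)
    (hM : ∀ i, r i / d i ≤ M) (hi : δ * (d ᵥ* Q) j ≤ d i * Q i j) :
    (r ᵥ* Q) j / (d ᵥ* Q) j ≤ M - δ * (M - r i / d i) := by
  rw [div_le_iff₀ hd']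
  have hsum : M * (d ᵥ* Q) j - (r ᵥ* Q) j = ∑ k, (M - r k / d k) * (d k * Q k j) := by
    simp only [vecMul, dotProduct, Finset.mul_sum, ← Finset.sum_sub_distrib]
    refine Finset.sum_congr rfl fun k _ => ?_
    field_simp [(hd k).ne']
  have hsingle : (M - r i / d i) * (d i * Q i j) ≤ ∑ k, (M - r k / d k) * (d k * Q k j) :=
    Finset.single_le_sum (f := fun k => (M - r k / d k) * (d k * Q k j))
      (fun k _ => mul_nonneg (sub_nonneg.2 (hM k)) (mul_nonneg (hd k).le (hQ k j)))
      (Finset.mem_univ i)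
  have := mul_le_mul_of_nonneg_left hi (sub_nonneg.2 (hM i))
  linarith

/-- If any two columns give weight at least `δ` to a common row, oscillation shrinks by the
factor `1 - δ`. -/
lemma Osc.contract {ι : Type*} [Fintype ι] {d r : ι → ℝ} {Q : Matrix ι ι ℝ}
    {δ D : ℝ} (hd : ∀ i, 0 < d i) (hQ : ∀ i j, 0 ≤ Q i j) (hd' : ∀ j, 0 < (d ᵥ* Q) j)
    (hδ : δ ≤ 1)
    (hcommon : ∀ j k, ∃ i, δ * (d ᵥ* Q) j ≤ d i * Q i j ∧ δ * (d ᵥ* Q) k ≤ d i * Q i k)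
    (h : Osc d r D) : Osc (d ᵥ* Q) (r ᵥ* Q) ((1 - δ) * D) := by
  intro j k
  obtain ⟨i, hij, hik⟩ := hcommon j k
  have : Nonempty ι := ⟨i⟩
  obtain ⟨iM, hM⟩ := Finite.exists_max fun i => r i / d i
  obtain ⟨im, hm⟩ := Finite.exists_min fun i => r i / d i
  have h1 := vecMul_div_vecMul_le hd hQ (hd' j) hM hij
  have h2 := vecMul_div_vecMul_le (r := -r) (M := -(r im / d im)) hd hQ (hd' k)
    (fun i => by simpa [neg_div] using hm i) hik
  rw [neg_vecMul, Pi.neg_apply, Pi.neg_apply, neg_div, neg_div] at h2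
  have h3 := mul_le_mul_of_nonneg_left (h iM im) (sub_nonneg.2 hδ)
  linarith

/-! ### Rows along a sequence of letters -/

lemma initialWord_zero (a : ℕ → Fin 2) : initialWord a 0 = [] := rfl

lemma initialWord_succ (a : ℕ → Fin 2) (t : ℕ) :
    initialWord a (t + 1) = initialWord a t ++ [a t] := by
  rw [initialWord, List.ofFn_succ', List.concat_eq_append]
  rfl

lemma initialWord_add (a : ℕ → Fin 2) (t m : ℕ) :
    initialWord a (t + m) = initialWord a t ++ initialWord (fun i => a (t + i)) m := by
  induction m with
  | zero => simp [initialWord_zero]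
  | succ m ih => rw [← Nat.add_assoc, initialWord_succ, ih, initialWord_succ, List.append_assoc]

lemma length_initialWord (a : ℕ → Fin 2) (t : ℕ) : (initialWord a t).length = t := by
  simp [initialWord]

/-- The row vector `r` multiplied by the matrices of the first `t` letters of `a`. -/
def rowAt (s : ℝ) (a : ℕ → Fin 2) (r : Fin (n + 1) → ℝ) (t : ℕ) : Fin (n + 1) → ℝ :=
  r ᵥ* ((initialWord a t).map (matC n s)).prod

lemma rowAt_zero (a : ℕ → Fin 2) (r : Fin (n + 1) → ℝ) : rowAt s a r 0 = r := by
  simp [rowAt, initialWord_zero]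

lemma rowAt_add (a : ℕ → Fin 2) (r : Fin (n + 1) → ℝ) (t m : ℕ) :
    rowAt s a r (t + m) =
      rowAt s a r t ᵥ* ((initialWord (fun i => a (t + i)) m).map (matC n s)).prod := by
  rw [rowAt, initialWord_add, List.map_append, List.prod_append, ← vecMul_vecMul, rowAt]

lemma rowAt_succ (a : ℕ → Fin 2) (r : Fin (n + 1) → ℝ) (t : ℕ) :
    rowAt s a r (t + 1) = rowAt s a r t ᵥ* matC n s (a t) := by
  rw [rowAt, initialWord_succ, List.map_append, List.prod_append, ← vecMul_vecMul,
    List.map_singleton, List.prod_singleton, rowAt]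

lemma rowAt_pos (hn : 1 ≤ n) (hs : 0 < s) (a : ℕ → Fin 2) {r : Fin (n + 1) → ℝ}
    (hr : ∀ j, 0 < r j) (t : ℕ) : ∀ j, 0 < rowAt s a r t j := by
  induction t with
  | zero => rwa [rowAt_zero]
  | succ t ih =>
    intro j
    rw [rowAt_succ]
    exact vecMul_matC_cases hn (0 < ·) _ ih (mul_pos hs (add_pos (ih _) (ih _))) j

lemma rowAt_add_le (hn : 1 ≤ n) (hs : 0 < s) (hs1 : s ≤ 1) (a : ℕ → Fin 2)
    {r : Fin (n + 1) → ℝ} (hr : ∀ j, 0 < r j) {t : ℕ} {K : ℝ} (hK : ∀ j, rowAt s a r t j ≤ K)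
    (m : ℕ) : ∀ j, rowAt s a r (t + m) j ≤ 2 ^ m * K := by
  induction m with
  | zero => simpa using hK
  | succ m ih =>
    intro j
    have hpos := rowAt_pos hn hs a hr (t + m)
    rw [← Nat.add_assoc, rowAt_succ]
    refine vecMul_matC_cases hn (· ≤ 2 ^ (m + 1) * K) _ (fun i => ?_) ?_ j
    · rw [pow_succ]
      linarith [ih i, hpos i]
    · refine (mul_le_of_le_one_left (add_pos (hpos _) (hpos _)).le hs1).trans ?_
      rw [pow_succ]
      linarith [ih 0, ih ⟨1, by omega⟩]

lemma Osc.rowAt_add (hn : 1 ≤ n) (hs : 0 < s) (a : ℕ → Fin 2) {d r : Fin (n + 1) → ℝ}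
    (hd : ∀ j, 0 < d j) {t : ℕ} {D : ℝ} (h : Osc (rowAt s a d t) (rowAt s a r t) D) (m : ℕ) :
    Osc (rowAt s a d (t + m)) (rowAt s a r (t + m)) D := by
  have hpos := rowAt_pos hn hs a hd (t + m)
  rw [Monkemeyer.rowAt_add] at hpos ⊢
  rw [Monkemeyer.rowAt_add a r]
  have := Osc.contract (δ := 0) (rowAt_pos hn hs a hd t) (prod_matC_nonneg hs.le _) hpos
    zero_le_one (fun j k => ⟨0, ?_⟩) h
  · simpa using this
  · have h1 := fun j : Fin (n + 1) => mul_nonneg (rowAt_pos hn hs a hd t 0).le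
      (prod_matC_nonneg hs.le (initialWord (fun i => a (t + i)) m) 0 j)
    simpa using ⟨h1 j, h1 k⟩

/-- A row is balanced if its entries differ by a factor at most `2`. -/
def Balanced {ι : Type*} (d : ι → ℝ) : Prop :=
  ∀ j k, d j ≤ 2 * d k

/-- After a balanced row, a scrambling block contracts oscillation by a factor which depends only
on the dimension. -/
lemma Osc.rowAt_add_block (hn : 1 ≤ n) (hs : 1 / 2 ≤ s) (hs1 : s ≤ 1) (a : ℕ → Fin 2)
    {d r : Fin (n + 1) → ℝ} (hd : ∀ j, 0 < d j) {t : ℕ} {D : ℝ} (hb : Balanced (rowAt s a d t))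
    (h : Osc (rowAt s a d t) (rowAt s a r t) D) :
    Osc (rowAt s a d (t + (n + 1) * n / 2)) (rowAt s a r (t + (n + 1) * n / 2))
      ((1 - (1 / 2) ^ (2 * ((n + 1) * n / 2) + 1)) * D) := by
  have hs0 : 0 < s := by linarith
  have hpos := rowAt_pos hn hs0 a hd (t + (n + 1) * n / 2)
  have hpos' := rowAt_pos hn hs0 a hd t
  have hle := fun i => rowAt_add_le hn hs0 hs1 a hd (fun j => hb j i) ((n + 1) * n / 2)
  set N := (n + 1) * n / 2 with hN
  rw [Monkemeyer.rowAt_add] at hpos hle ⊢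
  rw [Monkemeyer.rowAt_add a r]
  refine Osc.contract hpos' (prod_matC_nonneg hs0.le _) hpos
    (pow_le_one₀ (by norm_num) (by norm_num)) (fun j k => ?_) h
  obtain ⟨i, hij, hik⟩ := exists_common_row hn hs (initialWord (fun i => a (t + i)) N)
    (length_initialWord _ _) j k
  rw [← hN] at hij hik
  have key : ∀ j', (1 / 2 : ℝ) ^ (2 * N + 1) * (rowAt s a d t ᵥ*
      ((initialWord (fun i => a (t + i)) N).map (matC n s)).prod) j' ≤
      rowAt s a d t i * (1 / 2) ^ N := by
    intro j'
    refine (mul_le_mul_of_nonneg_left (hle i j') (by positivity)).trans_eq ?_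
    have h2 : (1 / 2 : ℝ) ^ N * 2 ^ N = 1 := by rw [← mul_pow]; norm_num
    calc (1 / 2 : ℝ) ^ (2 * N + 1) * (2 ^ N * (2 * rowAt s a d t i))
        = ((1 / 2 : ℝ) ^ N * 2 ^ N) * (rowAt s a d t i * (1 / 2) ^ N) := by ring
      _ = _ := by rw [h2, one_mul]
  exact ⟨i, (key j).trans (mul_le_mul_of_nonneg_left hij (hpos' i).le),
    (key k).trans (mul_le_mul_of_nonneg_left hik (hpos' i).le)⟩

theorem exists_osc_le_of_frequently_balanced (hn : 1 ≤ n) (hs : 1 / 2 ≤ s) (hs1 : s ≤ 1)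
    (a : ℕ → Fin 2) {d : Fin (n + 1) → ℝ} (hd : ∀ j, 0 < d j)
    (hb : ∀ t, ∃ t', t ≤ t' ∧ Balanced (rowAt s a d t')) (r : Fin (n + 1) → ℝ) {ε : ℝ}
    (hε : 0 < ε) : ∃ t, Osc (rowAt s a d t) (rowAt s a r t) ε := by
  obtain ⟨D, hD⟩ := exists_osc (rowAt s a d 0) (rowAt s a r 0)
  set q : ℝ := 1 - (1 / 2) ^ (2 * ((n + 1) * n / 2) + 1) with hq
  have hq0 : 0 ≤ q := sub_nonneg.2 (pow_le_one₀ (by norm_num) (by norm_num))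
  have hq1 : q < 1 := sub_lt_self _ (by positivity)
  have hpow : ∀ k : ℕ, ∃ t, Osc (rowAt s a d t) (rowAt s a r t) (q ^ k * D) := by
    intro k
    induction k with
    | zero => exact ⟨0, by simpa using hD⟩
    | succ k ih =>
      obtain ⟨t, ht⟩ := ih
      obtain ⟨t', htt', hbt'⟩ := hb t
      obtain ⟨m, rfl⟩ := Nat.exists_eq_add_of_le htt'
      refine ⟨t + m + (n + 1) * n / 2, ?_⟩
      rw [pow_succ', mul_assoc]
      exact (ht.rowAt_add hn (by linarith) a hd m).rowAt_add_block hn hs hs1 a hd hbt'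
  have hlim : Filter.Tendsto (fun k : ℕ => q ^ k * D) Filter.atTop (nhds 0) := by
    simpa using (tendsto_pow_atTop_nhds_zero_of_lt_one hq0 hq1).mul_const D
  obtain ⟨k, hk⟩ := (hlim.eventually_lt_const hε).exists
  obtain ⟨t, ht⟩ := hpow k
  exact ⟨t, fun i j => (ht i j).trans hk.le⟩

/-! ### Oscillation along the tent map and the Mönkemeyer map -/

theorem exists_osc_le_tent (hn : 1 ≤ n) (a : ℕ → Fin 2) (r : Fin (n + 1) → ℝ) {ε : ℝ}
    (hε : 0 < ε) : ∃ t, Osc (rowAt (1 / 2) a 1 t) (rowAt (1 / 2) a r t) ε := by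
  refine exists_osc_le_of_frequently_balanced hn le_rfl (by norm_num) a (fun _ => one_pos)
    (fun t => ⟨t, le_rfl, ?_⟩) r hε
  have h1 := one_vecMul_prod_matB hn (initialWord a t)
  rw [← matC_half] at h1
  change Balanced (1 ᵥ* _)
  rw [h1]
  intro j k
  norm_num

/-- The row of the denominators of the vertices of a Mönkemeyer simplex increases, and its last
entry is at most the sum of the first two. -/
lemma denominators_monotone (hn : 1 ≤ n) (a : ℕ → Fin 2) (t : ℕ) :
    Monotone (rowAt (n := n) 1 a 1 t) ∧
      rowAt (n := n) 1 a 1 t (Fin.last n) ≤ rowAt (n := n) 1 a 1 t 0 +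
        rowAt (n := n) 1 a 1 t ⟨1, by omega⟩ := by
  induction t with
  | zero =>
    rw [rowAt_zero]
    exact ⟨monotone_const, by norm_num [rowAt_zero]⟩
  | succ t ih =>
    obtain ⟨hmono, hlast⟩ := ih
    have hpos := rowAt_pos hn one_pos a (r := 1) (fun _ => one_pos) t
    rw [rowAt_succ]
    set d := rowAt (n := n) 1 a 1 t
    have ha := (a t).isLt
    have hle_last : ∀ i, d i ≤ d 0 + d ⟨1, by omega⟩ := fun i =>
      (hmono (Fin.le_last i)).trans hlast
    constructor
    · intro i j hij
      rcases eq_zero_or_mid_or_last j with rfl | ⟨h0, hj⟩ | rfl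
      · rw [Fin.le_zero_iff.1 hij]
      · rw [vecMul_matC_of_lt d _ h0 hj]
        rcases eq_zero_or_mid_or_last i with rfl | ⟨h0', hi⟩ | rfl
        · rw [vecMul_matC_zero hn]
          exact hmono (Fin.mk_le_mk.2 (by omega))
        · rw [vecMul_matC_of_lt d _ h0' hi]
          have : i.val ≤ j.val := hij
          exact hmono (Fin.mk_le_mk.2 (by omega))
        · have : n ≤ j.val := hij
          omega
      · rw [vecMul_matC_last hn, one_mul]
        exact vecMul_matC_cases hn (· ≤ d 0 + d ⟨1, by omega⟩) _ hle_last (by rw [one_mul]) i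
    · rw [vecMul_matC_last hn, vecMul_matC_zero hn, one_mul]
      have h0 : d 0 ≤ d ⟨a t, by omega⟩ := hmono (Fin.zero_le _)
      rcases hn.eq_or_lt with rfl | hlt
      · have : (⟨1, by omega⟩ : Fin (1 + 1)) = Fin.last 1 := rfl
        rw [this, vecMul_matC_last le_rfl, one_mul]
        exact le_add_of_nonneg_left (hpos _).le
      · rw [vecMul_matC_of_lt d (j := ⟨1, by omega⟩) _ le_rfl hlt]
        exact add_le_add h0 (hmono (Fin.mk_le_mk.2 (by omega)))

/-- A letter `1` discards the first vertex, the only one whose denominator may be small compared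
with the others. -/
lemma balanced_denominators (hn : 1 ≤ n) {a : ℕ → Fin 2} {t : ℕ} (ht : a t = 1) :
    Balanced (rowAt (n := n) 1 a 1 (t + 1)) := by
  have hmono := (denominators_monotone hn a (t + 1)).1
  have hmono' := (denominators_monotone hn a t).1
  suffices rowAt (n := n) 1 a 1 (t + 1) (Fin.last n) ≤ 2 * rowAt 1 a 1 (t + 1) 0 from
    fun j k => (hmono (Fin.le_last j)).trans (this.trans (by linarith [hmono (Fin.zero_le k)]))
  rw [rowAt_succ, vecMul_matC_last hn, vecMul_matC_zero hn]
  have h1 : (⟨a t, by omega⟩ : Fin (n + 1)) = ⟨1, by omega⟩ := Fin.ext (by simp [ht])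
  rw [h1]
  linarith [hmono' (Fin.zero_le (⟨1, by omega⟩ : Fin (n + 1)))]

/-- While the letter is `0`, the first vertex stays put and is added to all others in turn: so the
latter have growing denominators and approach the former. -/
lemma exists_osc_le_of_eventually_zero (hn : 1 ≤ n) {a : ℕ → Fin 2} {t₀ : ℕ}
    (ha : ∀ t, t₀ ≤ t → a t = 0) (r : Fin (n + 1) → ℝ) {ε : ℝ} (hε : 0 < ε) :
    ∃ t, Osc (rowAt 1 a 1 t) (rowAt 1 a r t) ε := by
  have hpos := fun t => rowAt_pos (n := n) hn one_pos a (r := 1) (fun _ => one_pos) t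
  set d := rowAt (n := n) 1 a 1 with hd
  set p := d t₀ 0
  have hp : 0 < p := hpos t₀ 0
  set ρ := rowAt 1 a r t₀ 0 / p
  have hzero : ∀ m, (⟨a (t₀ + m), by omega⟩ : Fin (n + 1)) = 0 := fun m =>
    Fin.ext (by simp [ha _ (Nat.le_add_right t₀ m)])
  have hd0 : ∀ m, d (t₀ + m) 0 = p := by
    intro m
    induction m with
    | zero => rfl
    | succ m ih => rw [← Nat.add_assoc, hd, rowAt_succ, vecMul_matC_zero hn, hzero]; exact ih
  -- The deviation from the ratio at the fixed vertex vanishes there, so it is merely permuted.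
  set ψ : ℕ → Fin (n + 1) → ℝ := fun m => rowAt 1 a r (t₀ + m) - ρ • d (t₀ + m) with hψ
  have hψs : ∀ m, ψ (m + 1) = ψ m ᵥ* matC n 1 (a (t₀ + m)) := by
    intro m
    simp only [hψ, hd]
    rw [← Nat.add_assoc, rowAt_succ, rowAt_succ, sub_vecMul, smul_vecMul]
  have hψ0 : ∀ m, ψ m 0 = 0 := by
    intro m
    induction m with
    | zero =>
      change rowAt 1 a r t₀ 0 - ρ * p = 0
      rw [div_mul_cancel₀ _ hp.ne', sub_self]
    | succ m ih => rw [hψs, vecMul_matC_zero hn, hzero]; exact ih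
  obtain ⟨i₀, hi₀⟩ := Finite.exists_max fun i => |ψ 0 i|
  set K := |ψ 0 i₀|
  have hK : 0 ≤ K := abs_nonneg _
  have hψK : ∀ m j, |ψ m j| ≤ K := by
    intro m
    induction m with
    | zero => exact hi₀
    | succ m ih =>
      rw [hψs]
      refine vecMul_matC_cases hn (|·| ≤ K) _ ih ?_
      rw [hψ0, zero_add, one_mul]
      exact ih _
  have hgrow : ∀ m (j : Fin (n + 1)), 1 ≤ j.val → (m + j.val) * p ≤ n * d (t₀ + m) j := by
    intro m
    induction m with
    | zero =>
      intro j _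
      have h1 : p ≤ d t₀ j := (denominators_monotone hn a t₀).1 (Fin.zero_le j)
      have h2 : (j.val : ℝ) ≤ n := by exact_mod_cast Nat.lt_succ_iff.1 j.isLt
      simpa using mul_le_mul h2 h1 hp.le (by positivity)
    | succ m ih =>
      intro j hj
      rw [← Nat.add_assoc, hd, rowAt_succ]
      rcases eq_zero_or_mid_or_last j with rfl | ⟨h0, hlt⟩ | rfl
      · simp at hj
      · rw [vecMul_matC_of_lt _ _ h0 hlt]
        refine le_trans (le_of_eq ?_) (ih ⟨j + 1, by omega⟩ (by simp))
        push_cast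
        ring
      · rw [vecMul_matC_last hn, one_mul]
        have h1 := ih ⟨1, by omega⟩ le_rfl
        have h2 := hd0 m
        rw [hd] at h1 h2
        rw [h2, mul_add]
        push_cast [Fin.val_last] at h1 ⊢
        linarith
  have hdiv : ∀ m j, rowAt 1 a r (t₀ + m) j / d (t₀ + m) j = ρ + ψ m j / d (t₀ + m) j := by
    intro m j
    have := (hpos (t₀ + m) j).ne'
    simp only [hψ, Pi.sub_apply, Pi.smul_apply, smul_eq_mul]
    field_simp
    ring
  obtain ⟨m, hm⟩ := exists_nat_gt (2 * (K * n) / (p * ε))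
  have hm0 : (0 : ℝ) < m := lt_of_le_of_lt (by positivity) hm
  have hbound : ∀ j, |ψ m j / d (t₀ + m) j| ≤ ε / 2 := by
    intro j
    rcases Nat.eq_zero_or_pos j.val with h | h
    · obtain rfl : j = 0 := Fin.ext h
      rw [hψ0, zero_div, abs_zero]
      positivity
    · rw [abs_div, abs_of_pos (hpos (t₀ + m) j), div_le_iff₀ (hpos (t₀ + m) j)]
      refine (hψK m j).trans ?_
      have h1 := hgrow m j h
      have h2 : 0 ≤ (j.val : ℝ) * p := by positivity
      rw [div_lt_iff₀ (by positivity)] at hm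
      have h3 : m * p ≤ n * d (t₀ + m) j := by linarith
      have h4 := mul_le_mul_of_nonneg_right h3 hε.le
      have hn0 : (0 : ℝ) < n := by exact_mod_cast hn
      refine le_of_mul_le_mul_left ?_ hn0
      linarith
  refine ⟨t₀ + m, fun j k => ?_⟩
  rw [hdiv, hdiv]
  linarith [(abs_le.1 (hbound j)).2, (abs_le.1 (hbound k)).1]

theorem exists_osc_le_monkemeyer (hn : 1 ≤ n) (a : ℕ → Fin 2) (r : Fin (n + 1) → ℝ) {ε : ℝ}
    (hε : 0 < ε) : ∃ t, Osc (rowAt 1 a 1 t) (rowAt 1 a r t) ε := by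
  by_cases h : ∀ t, ∃ t', t ≤ t' ∧ a t' = 1
  · refine exists_osc_le_of_frequently_balanced hn (by norm_num) le_rfl a (fun _ => one_pos)
      (fun t => ?_) r hε
    obtain ⟨t', ht, hat⟩ := h t
    exact ⟨t' + 1, by omega, balanced_denominators hn hat⟩
  · push Not at h
    obtain ⟨t₀, ht₀⟩ := h
    exact exists_osc_le_of_eventually_zero hn (fun t ht => by have := ht₀ t ht; omega) r hε

/-! ### Simplices as sections of cones -/

lemma lift_castSucc (x : Fin n → ℝ) (i : Fin n) : lift x i.castSucc = x i := by
  simp [lift]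

lemma lift_last (x : Fin n → ℝ) : lift x (Fin.last n) = 1 := by
  simp [lift]

/-- The points of `ℝⁿ` with projective coordinates in the cone spanned by the columns of `W`. -/
def coneSet (W : Matrix (Fin (n + 1)) (Fin (n + 1)) ℝ) : Set (Fin n → ℝ) :=
  {x | ∃ c : Fin (n + 1) → ℝ, (∀ j, 0 ≤ c j) ∧ lift x = W *ᵥ c}

lemma lift_proj {v : Fin (n + 1) → ℝ} (hv : v (Fin.last n) ≠ 0) :
    lift (proj v) = (v (Fin.last n))⁻¹ • v := by
  ext i
  refine Fin.lastCases ?_ (fun i => ?_) i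
  · simp [lift_last, hv]
  · simp [lift_castSucc, proj, div_eq_inv_mul]

lemma simplexOf_eq_coneSet {W : Matrix (Fin (n + 1)) (Fin (n + 1)) ℝ}
    (hW : ∀ j, 0 < W (Fin.last n) j) : simplexOf W = coneSet W := by
  apply Set.Subset.antisymm
  · refine convexHull_min ?_ ?_
    · rintro _ ⟨j, rfl⟩
      refine ⟨Pi.single j (W (Fin.last n) j)⁻¹, fun i => ?_, ?_⟩
      · rcases eq_or_ne i j with rfl | h
        · simpa using (hW i).le
        · simp [h]
      · rw [lift_proj (v := W.col j) (hW j).ne']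
        ext i
        simp [mulVec_single, mul_comm]
    · rintro x ⟨c, hc, hx⟩ y ⟨d, hd, hy⟩ p q hp hq hpq
      refine ⟨p • c + q • d, fun j => ?_, ?_⟩
      · have := mul_nonneg hp (hc j)
        have := mul_nonneg hq (hd j)
        simp only [Pi.add_apply, Pi.smul_apply, smul_eq_mul]
        linarith
      · rw [mulVec_add, mulVec_smul, mulVec_smul, ← hx, ← hy]
        ext i
        refine Fin.lastCases ?_ (fun i => ?_) i
        · simp [lift_last, hpq]
        · simp [lift_castSucc]
  · rintro x ⟨c, hc, hx⟩
    have hsum : ∑ j, c j * W (Fin.last n) j = 1 := by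
      rw [← lift_last x, hx, mulVec, dotProduct]
      exact Finset.sum_congr rfl fun j _ => mul_comm _ _
    have hx' : x = ∑ j, (c j * W (Fin.last n) j) • proj (W.col j) := by
      ext i
      rw [← lift_castSucc x i, hx, mulVec, dotProduct, Finset.sum_apply]
      refine Finset.sum_congr rfl fun j _ => ?_
      have := (hW j).ne'
      simp only [proj, Pi.smul_apply, smul_eq_mul, col_apply]
      field_simp
    rw [hx']
    exact (convex_convexHull ℝ _).sum_mem (fun j _ => mul_nonneg (hc j) (hW j).le) hsum
      fun j _ => subset_convexHull ℝ _ ⟨j, rfl⟩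

lemma isCompact_simplexOf (W : Matrix (Fin (n + 1)) (Fin (n + 1)) ℝ) :
    IsCompact (simplexOf W) :=
  (Set.finite_range _).isCompact_convexHull ℝ

lemma nonempty_simplexOf (W : Matrix (Fin (n + 1)) (Fin (n + 1)) ℝ) :
    (simplexOf W).Nonempty :=
  (Set.range_nonempty _).convexHull

/-! ### Inverting the matrices -/

lemma matV_last (j : Fin (n + 1)) : matV n (Fin.last n) j = 1 := by
  simp [matV]

lemma matV_mulVec_last (c : Fin (n + 1) → ℝ) : (matV n *ᵥ c) (Fin.last n) = ∑ j, c j := by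
  simp [mulVec, dotProduct, matV_last]

lemma isUnit_det_of_mulVec {ι : Type*} [Fintype ι] [DecidableEq ι] {W : Matrix ι ι ℝ}
    (h : ∀ c, W *ᵥ c = 0 → c = 0) : IsUnit W.det := by
  rw [isUnit_iff_ne_zero]
  intro hdet
  obtain ⟨v, hv, hv0⟩ := exists_mulVec_eq_zero_iff.2 hdet
  exact hv (h v hv0)

lemma isUnit_det_matV : IsUnit (matV n).det := by
  refine isUnit_det_of_mulVec fun c hc => ?_
  have hpos : ∀ m (hm : m < n + 1), 1 ≤ m → c ⟨m, hm⟩ = 0 := by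
    intro m
    induction m using Nat.strong_induction_on with
    | _ m ih =>
      intro hm h1
      have h := congrFun hc ⟨n - m, by omega⟩
      rw [mulVec, dotProduct, Finset.sum_eq_single (⟨m, hm⟩ : Fin (n + 1))] at h
      · have h2 : n - m + m ≤ n := by omega
        simpa [matV, h1, h2] using h
      · intro j _ hj
        have hj' : j.val ≠ m := fun h => hj (Fin.ext h)
        by_cases hlt : 1 ≤ j.val ∧ j.val < m
        · rw [ih j hlt.2 j.isLt hlt.1, mul_zero]
        · have h2 : ¬ (n - m = n ∨ (1 ≤ j.val ∧ n - m + j.val ≤ n)) := by omega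
          simp only [matV, of_apply, if_neg h2, zero_mul]
      · simp
  have h0 : c 0 = 0 := by
    have h := matV_mulVec_last c
    rw [hc, Finset.sum_eq_single (0 : Fin (n + 1))] at h
    · exact h.symm
    · intro j _ hj
      exact hpos j j.isLt (Nat.pos_of_ne_zero fun h => hj (Fin.ext h))
    · simp
  ext j
  rcases Nat.eq_zero_or_pos j.val with h | h
  · obtain rfl : j = 0 := Fin.ext h
    exact h0
  · exact hpos j j.isLt h

lemma matC_mulVec_zero (hn : 1 ≤ n) (a : Fin 2) (c : Fin (n + 1) → ℝ) :
    (matC n s a *ᵥ c) 0 = (if a = 0 then c 0 else 0) + s * c (Fin.last n) := by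
  have hn0 : n ≠ 0 := by omega
  rw [mulVec, dotProduct, Finset.sum_eq_add (0 : Fin (n + 1)) (Fin.last n)]
  · fin_cases a <;> simp [matC, matA, hn0.symm]
  · simp [Fin.ext_iff, hn0.symm]
  · intro i _ hi
    have h0 : ¬ (i.val = n) := fun h => hi.2 (Fin.ext h)
    simp [matC, matA, h0, hi.1]
  · simp
  · simp

lemma matC_mulVec_one (hn : 1 ≤ n) (a : Fin 2) (c : Fin (n + 1) → ℝ) :
    (matC n s a *ᵥ c) ⟨1, by omega⟩ = (if a = 1 then c 0 else 0) + s * c (Fin.last n) := by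
  have hn0 : n ≠ 0 := by omega
  rw [mulVec, dotProduct, Finset.sum_eq_add (0 : Fin (n + 1)) (Fin.last n)]
  · fin_cases a <;> simp [matC, matA, hn0.symm]
  · simp [Fin.ext_iff, hn0.symm]
  · intro i _ hi
    have h0 : ¬ (i.val = n) := fun h => hi.2 (Fin.ext h)
    simp [matC, matA, h0, hi.1]
  · simp
  · simp

lemma matC_mulVec_succ (a : Fin 2) (c : Fin (n + 1) → ℝ) {j : Fin (n + 1)}
    (h0 : 1 ≤ j.val) (hj : j.val < n) :
    (matC n s a *ᵥ c) ⟨j + 1, by omega⟩ = c j := by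
  have ha := a.isLt
  rw [mulVec, dotProduct, Finset.sum_eq_single j]
  · simp [matC, matA, hj.ne, h0]
  · intro i _ hi
    have h1 : ¬ (j.val = i.val) := fun h => hi (Fin.ext h.symm)
    have h2 : ¬ (j.val + 1 = a.val) := by omega
    have h3 : ¬ (j.val = 0) := by omega
    simp [matC, matA, h1, h2, h3]
  · simp

/-- Two points in the cones over the two halves coincide only on the common facet; so the
coordinates of a point with respect to the vertices do not depend on the half. -/
lemma matC_mulVec_injective (hn : 1 ≤ n) (hs : 0 < s) {a b : Fin 2} {c d : Fin (n + 1) → ℝ}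
    (h : matC n s a *ᵥ c = matC n s b *ᵥ d)
    (hab : a = b ∨ ((∀ j, 0 ≤ c j) ∧ ∀ j, 0 ≤ d j)) : c = d := by
  have h0 := congrFun h 0
  have h1 := congrFun h ⟨1, by omega⟩
  rw [matC_mulVec_zero hn, matC_mulVec_zero hn] at h0
  rw [matC_mulVec_one hn, matC_mulVec_one hn] at h1
  have key : c 0 = d 0 ∧ s * c (Fin.last n) = s * d (Fin.last n) := by
    rcases hab with rfl | ⟨hc, hd⟩
    · have ha : a = 0 ∨ a = 1 := by omega
      rcases ha with rfl | rfl <;>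
        simp only [if_true, if_false, zero_ne_one, one_ne_zero, zero_add] at h0 h1 <;>
        constructor <;> linarith
    · have ha : a = 0 ∨ a = 1 := by omega
      have hb : b = 0 ∨ b = 1 := by omega
      have := hc 0
      have := hd 0
      rcases ha with rfl | rfl <;> rcases hb with rfl | rfl <;>
        simp only [if_true, if_false, zero_ne_one, one_ne_zero, zero_add] at h0 h1 <;>
        constructor <;> linarith
  ext j
  rcases eq_zero_or_mid_or_last j with rfl | ⟨h2, hj⟩ | rfl
  · exact key.1
  · have := congrFun h ⟨j + 1, by omega⟩
    rwa [matC_mulVec_succ a c h2 hj, matC_mulVec_succ b d h2 hj] at this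
  · exact mul_left_cancel₀ hs.ne' key.2

lemma isUnit_det_matC (hn : 1 ≤ n) (hs : 0 < s) (a : Fin 2) : IsUnit (matC n s a).det :=
  isUnit_det_of_mulVec fun c hc => matC_mulVec_injective hn hs (a := a) (b := a) (d := 0)
    (by rw [hc, mulVec_zero]) (Or.inl rfl)

/-! ### Cells are simplices -/

lemma matV_mul_last (P : Matrix (Fin (n + 1)) (Fin (n + 1)) ℝ) (j : Fin (n + 1)) :
    (matV n * P) (Fin.last n) j = (1 ᵥ* P) j := by
  simp [mul_apply, vecMul, dotProduct, matV_last]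

lemma one_vecMul_matC_pos (hn : 1 ≤ n) (hs : 0 < s) (a : Fin 2) (j : Fin (n + 1)) :
    0 < ((1 : Fin (n + 1) → ℝ) ᵥ* matC n s a) j :=
  vecMul_matC_cases hn (0 < ·) a (fun _ => one_pos) (by simpa using hs) j

lemma mulVec_nonneg {ι : Type*} [Fintype ι] {P : Matrix ι ι ℝ} {c : ι → ℝ}
    (hP : ∀ i j, 0 ≤ P i j) (hc : ∀ j, 0 ≤ c j) (i : ι) : 0 ≤ (P *ᵥ c) i :=
  Finset.sum_nonneg fun j _ => mul_nonneg (hP i j) (hc j)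

lemma coneSet_mul_subset {W P : Matrix (Fin (n + 1)) (Fin (n + 1)) ℝ} (hP : ∀ i j, 0 ≤ P i j) :
    coneSet (W * P) ⊆ coneSet W := by
  rintro x ⟨c, hc, hx⟩
  exact ⟨P *ᵥ c, mulVec_nonneg hP hc, by rw [hx, mulVec_mulVec]⟩

lemma baseSimplex_eq : baseSimplex n = coneSet (matV n) :=
  simplexOf_eq_coneSet fun j => by rw [matV_last]; exact one_pos

/-- Multiplying the last column by a positive number does not affect the cone. -/
lemma half_eq (hn : 1 ≤ n) (hs : 0 < s) (a : Fin 2) :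
    half n a = coneSet (matV n * matC n s a) := by
  rw [half, ← matC_one, simplexOf_eq_coneSet fun j => by
    rw [matV_mul_last]; exact one_vecMul_matC_pos hn one_pos a j]
  have hmul : ∀ t u : ℝ, matC n (t * u) a =
      matC n t a * Matrix.diagonal fun j => if j.val = n then u else 1 := by
    intro t u
    ext i j
    rw [mul_diagonal]
    simp only [matC, of_apply]
    split_ifs <;> ring
  have hnonneg : ∀ u : ℝ, 0 < u → ∀ i j : Fin (n + 1),
      0 ≤ (Matrix.diagonal fun j : Fin (n + 1) => if j.val = n then u else 1) i j := by
    intro u hu i j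
    rw [diagonal_apply]
    split_ifs <;> positivity
  apply Set.Subset.antisymm
  · have := hmul s s⁻¹
    rw [mul_inv_cancel₀ hs.ne'] at this
    rw [this, ← mul_assoc]
    exact coneSet_mul_subset (hnonneg _ (inv_pos.2 hs))
  · have := hmul 1 s
    rw [one_mul] at this
    rw [this, ← mul_assoc]
    exact coneSet_mul_subset (hnonneg _ hs)

/-- In projective coordinates, `f` restricted to the half `a` is inverse to the linear map which
sends the columns of `matV n` to those of `matV n * matC n s a`; the factor `μ` is there because
projective coordinates are determined only up to a positive multiple. -/
def HasInverseBranches (n : ℕ) (s : ℝ) (f : (Fin n → ℝ) → (Fin n → ℝ)) : Prop :=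
  ∀ a x (c : Fin (n + 1) → ℝ), (∀ j, 0 ≤ c j) → lift x = (matV n * matC n s a) *ᵥ c →
    ∃ μ : ℝ, 0 < μ ∧ lift (f x) = μ • (matV n *ᵥ c)

lemma cell_eq_coneSet (hn : 1 ≤ n) (hs : 0 < s) {f : (Fin n → ℝ) → (Fin n → ℝ)}
    (hf : HasInverseBranches n s f) (w : List (Fin 2)) :
    cell n f w = coneSet (matV n * (w.map (matC n s)).prod) := by
  induction w with
  | nil => simp [cell, baseSimplex_eq]
  | cons a w ih =>
    rw [cell, ih, half_eq hn hs, List.map_cons, List.prod_cons]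
    set P := (w.map (matC n s)).prod with hP
    ext x
    constructor
    · rintro ⟨⟨c, hc, hx⟩, d, hd, hfx⟩
      obtain ⟨μ, hμ, hfx'⟩ := hf a x c hc hx
      have hcd : μ • c = P *ᵥ d := by
        apply (mulVec_injective_iff_isUnit.2 ((isUnit_iff_isUnit_det _).2 (isUnit_det_matV (n := n))))
        rw [mulVec_smul, ← hfx', hfx, mulVec_mulVec]
      refine ⟨μ⁻¹ • d, fun j => mul_nonneg (inv_pos.2 hμ).le (hd j), ?_⟩
      rw [hx, ← mul_assoc, ← mulVec_mulVec _ _ P, mulVec_smul, ← hcd, smul_smul,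
        inv_mul_cancel₀ hμ.ne', one_smul]
    · rintro ⟨d, hd, hx⟩
      rw [← mul_assoc, ← mulVec_mulVec] at hx
      have hPd : ∀ j, 0 ≤ (P *ᵥ d) j := 
        mulVec_nonneg (prod_matC_nonneg hs.le w) hd
      obtain ⟨μ, hμ, hfx⟩ := hf a x _ hPd hx
      refine ⟨⟨_, hPd, hx⟩, μ • d, fun j => mul_nonneg hμ.le (hd j), ?_⟩
      rw [hfx, mulVec_smul, mulVec_mulVec]

/-- Two averages of the ratios of `r` to `d` differ by at most the oscillation. -/
lemma Osc.dotProduct_sub_le {ι : Type*} [Fintype ι] {d r c e : ι → ℝ} {D : ℝ}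
    (h : Osc d r D) (hd : ∀ j, 0 < d j) (hc : ∀ j, 0 ≤ c j) (he : ∀ j, 0 ≤ e j)
    (hdc : d ⬝ᵥ c = 1) (hde : d ⬝ᵥ e = 1) : r ⬝ᵥ c - r ⬝ᵥ e ≤ D := by
  have h1 : r ⬝ᵥ c - r ⬝ᵥ e =
      ∑ j, ∑ k, (d j * c j) * (d k * e k) * (r j / d j - r k / d k) := by
    have e1 : r ⬝ᵥ c = (r ⬝ᵥ c) * (d ⬝ᵥ e) := by rw [hde, mul_one]
    have e2 : r ⬝ᵥ e = (d ⬝ᵥ c) * (r ⬝ᵥ e) := by rw [hdc, one_mul]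
    rw [e1, e2, dotProduct, dotProduct, dotProduct, dotProduct, Finset.sum_mul_sum,
      Finset.sum_mul_sum, ← Finset.sum_sub_distrib]
    refine Finset.sum_congr rfl fun j _ => ?_
    rw [← Finset.sum_sub_distrib]
    refine Finset.sum_congr rfl fun k _ => ?_
    have := (hd j).ne'
    have := (hd k).ne'
    field_simp
  have h2 : ∑ j, ∑ k, (d j * c j) * (d k * e k) * D = D := by
    have : (d ⬝ᵥ c) * (d ⬝ᵥ e) * D = D := by rw [hdc, hde, one_mul, one_mul]
    rw [dotProduct, dotProduct, Finset.sum_mul_sum, Finset.sum_mul] at this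
    simpa only [Finset.sum_mul] using this
  rw [h1, ← h2]
  exact Finset.sum_le_sum fun j _ => Finset.sum_le_sum fun k _ =>
    mul_le_mul_of_nonneg_left (h j k)
      (mul_nonneg (mul_nonneg (hd j).le (hc j)) (mul_nonneg (hd k).le (he k)))

/-- The cells along a sequence shrink to a point as soon as every row of coordinates oscillates
arbitrarily little relative to the row of denominators. -/
theorem iInter_cell_eq_singleton (hn : 1 ≤ n) (hs : 0 < s) {f : (Fin n → ℝ) → (Fin n → ℝ)}
    (hf : HasInverseBranches n s f) (a : ℕ → Fin 2)
    (hosc : ∀ (r : Fin (n + 1) → ℝ) (ε : ℝ), 0 < ε →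
      ∃ t, Osc (rowAt s a 1 t) (rowAt s a r t) ε) :
    ∃ x, (⋂ t, cell n f (initialWord a t)) = {x} := by
  have hpos := fun t => rowAt_pos (n := n) hn hs a (r := 1) (fun _ => one_pos) t
  have hcone := fun t => cell_eq_coneSet hn hs hf (initialWord a t)
  have hsimplex : ∀ t, cell n f (initialWord a t) =
      simplexOf (matV n * ((initialWord a t).map (matC n s)).prod) := fun t => by
    rw [hcone, simplexOf_eq_coneSet fun j => by rw [matV_mul_last]; exact hpos t j]
  have hcompact : ∀ t, IsCompact (cell n f (initialWord a t)) := fun t => by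
    rw [hsimplex]; exact isCompact_simplexOf _
  obtain ⟨x, hx⟩ := IsCompact.nonempty_iInter_of_sequence_nonempty_isCompact_isClosed
    (fun t => cell n f (initialWord a t))
    (fun t => by
      rw [hcone, hcone, initialWord_succ, List.map_append, List.prod_append, ← mul_assoc]
      exact coneSet_mul_subset (prod_matC_nonneg hs.le [a t]))
    (fun t => by rw [hsimplex]; exact nonempty_simplexOf _)
    (hcompact 0) (fun t => (hcompact t).isClosed)
  have hle : ∀ y ∈ ⋂ t, cell n f (initialWord a t), ∀ z ∈ ⋂ t, cell n f (initialWord a t),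
      y ≤ z := by
    intro y hy z hz i
    refine le_of_forall_pos_le_add fun ε hε => ?_
    obtain ⟨t, ht⟩ := hosc (matV n i.castSucc) ε hε
    have hy' := Set.mem_iInter.1 hy t
    have hz' := Set.mem_iInter.1 hz t
    rw [hcone] at hy' hz'
    obtain ⟨c, hc, hyc⟩ := hy'
    obtain ⟨e, he, hze⟩ := hz'
    have hrow : ∀ k (c : Fin (n + 1) → ℝ),
        ((matV n * ((initialWord a t).map (matC n s)).prod) *ᵥ c) k =
          rowAt s a (matV n k) t ⬝ᵥ c := fun k c => rfl
    have hlast : matV n (Fin.last n) = 1 := funext matV_last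
    have hdc := congrFun hyc (Fin.last n)
    have hde := congrFun hze (Fin.last n)
    have hyi := congrFun hyc i.castSucc
    have hzi := congrFun hze i.castSucc
    rw [lift_last, hrow, hlast] at hdc hde
    rw [lift_castSucc, hrow] at hyi hzi
    rw [hyi, hzi]
    linarith [ht.dotProduct_sub_le (hpos t) hc he hdc.symm hde.symm]
  exact ⟨x, Set.eq_singleton_iff_unique_mem.2
    ⟨hx, fun y hy => le_antisymm (hle y hy x hx) (hle x hx y hy)⟩⟩

/-! ### The branches of the two maps -/

lemma branch_mulVec (hn : 1 ≤ n) (hs : 0 < s) (a : Fin 2) {v c : Fin (n + 1) → ℝ}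
    (hv : v = (matV n * matC n s a) *ᵥ c) :
    (matV n * (matC n s a)⁻¹ * (matV n)⁻¹) *ᵥ v = matV n *ᵥ c := by
  rw [hv, mulVec_mulVec, mul_assoc, mul_assoc, ← mul_assoc (matV n)⁻¹,
    nonsing_inv_mul _ isUnit_det_matV, one_mul, nonsing_inv_mul _ (isUnit_det_matC hn hs a),
    mul_one]

/-- A map which agrees on each half with one of the branches whose half contains the point has the
right inverse branches, because the branches agree on the common facet. -/
lemma hasInverseBranches_of_branch (hn : 1 ≤ n) (hs : 0 < s) {f : (Fin n → ℝ) → (Fin n → ℝ)}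
    (g : Fin 2 → (Fin n → ℝ) → (Fin n → ℝ)) (hfg : ∀ x a, x ∈ half n a →
      ∃ b, x ∈ half n b ∧ f x = g b x)
    (hg : ∀ b x (c : Fin (n + 1) → ℝ), (∀ j, 0 ≤ c j) → lift x = (matV n * matC n s b) *ᵥ c →
      ∃ μ : ℝ, 0 < μ ∧ lift (g b x) = μ • (matV n *ᵥ c)) : HasInverseBranches n s f := by
  intro a x c hc hx
  obtain ⟨b, hb, hfx⟩ := hfg x a (by rw [half_eq hn hs]; exact ⟨c, hc, hx⟩)
  rw [half_eq hn hs] at hb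
  obtain ⟨d, hd, hx'⟩ := hb
  obtain rfl : c = d := by
    refine matC_mulVec_injective hn hs (a := a) (b := b) ?_ (Or.inr ⟨hc, hd⟩)
    apply (mulVec_injective_iff_isUnit.2 ((isUnit_iff_isUnit_det _).2 (isUnit_det_matV (n := n))))
    rw [mulVec_mulVec, mulVec_mulVec, ← hx, hx']
  rw [hfx]
  exact hg b x c hc hx'

open Classical in
lemma exists_branch (g : Fin 2 → (Fin n → ℝ) → (Fin n → ℝ)) (x : Fin n → ℝ) (a : Fin 2)
    (hx : x ∈ half n a) :
    ∃ b, x ∈ half n b ∧ (if x ∈ half n 0 then g 0 x else g 1 x) = g b x := by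
  by_cases h : x ∈ half n 0
  · exact ⟨0, h, if_pos h⟩
  · have ha : a = 0 ∨ a = 1 := by omega
    rcases ha with rfl | rfl
    · exact absurd hx h
    · exact ⟨1, hx, if_neg h⟩

lemma hasInverseBranches_monkemeyerMap (hn : 1 ≤ n) :
    HasInverseBranches n 1 (monkemeyerMap n) := by
  refine hasInverseBranches_of_branch hn one_pos (monkemeyerBranch n)
    (exists_branch (monkemeyerBranch n)) fun b x c hc hx => ?_
  have hpos : 0 < (matV n *ᵥ c) (Fin.last n) := by
    rw [matV_mulVec_last]
    refine (Finset.sum_nonneg fun j _ => hc j).lt_of_ne' fun h0 => ?_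
    have hc0 : c = 0 := funext fun j =>
      (Finset.sum_eq_zero_iff_of_nonneg fun j _ => hc j).1 h0 j (Finset.mem_univ j)
    have := congrFun hx (Fin.last n)
    rw [hc0, mulVec_zero, lift_last] at this
    exact one_ne_zero this
  refine ⟨((matV n *ᵥ c) (Fin.last n))⁻¹, inv_pos.2 hpos, ?_⟩
  rw [monkemeyerBranch, ← matC_one, branch_mulVec hn one_pos b hx, lift_proj hpos.ne']

lemma hasInverseBranches_tentMap (hn : 1 ≤ n) :
    HasInverseBranches n (1 / 2) (tentMap n) := by
  refine hasInverseBranches_of_branch hn (by norm_num) (tentBranch n)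
    (exists_branch (tentBranch n)) fun b x c hc hx => ⟨1, one_pos, ?_⟩
  -- The matrices `B_a` preserve the sum of coordinates, so no normalization is needed.
  have hlast : (matV n *ᵥ c) (Fin.last n) = 1 := by
    have h := congrFun hx (Fin.last n)
    rw [lift_last, mulVec, dotProduct] at h
    simp only [matV_mul_last, matC_half, one_vecMul_matB hn] at h
    rw [matV_mulVec_last, h]
    simp
  rw [one_smul]
  ext i
  refine Fin.lastCases ?_ (fun i => ?_) i
  · rw [lift_last, hlast]
  · rw [lift_castSucc, tentBranch, ← matC_half, branch_mulVec hn (by norm_num) b hx]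

end Monkemeyer

theorem mainTheorem6 (n : ℕ) (hn : 1 ≤ n) :
    (∀ a : ℕ → Fin 2,
      (∃ x : Fin n → ℝ,
        (⋂ t : ℕ, Monkemeyer.monkemeyerSimplex n (Monkemeyer.initialWord a t)) = {x}) ∧
      (∃ y : Fin n → ℝ,
        (⋂ t : ℕ, Monkemeyer.tentSimplex n (Monkemeyer.initialWord a t)) = {y})) ∧
    (∀ w : List (Fin 2), w.length = (n + 1) * n / 2 →
      Monkemeyer.IsScrambling (w.map (Monkemeyer.matB n)).prod) :=
  ⟨fun a =>
    ⟨Monkemeyer.iInter_cell_eq_singleton hn one_pos (Monkemeyer.hasInverseBranches_monkemeyerMap hn)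
        a fun r _ => Monkemeyer.exists_osc_le_monkemeyer hn a r,
      Monkemeyer.iInter_cell_eq_singleton hn (by norm_num)
        (Monkemeyer.hasInverseBranches_tentMap hn) a fun r _ =>
          Monkemeyer.exists_osc_le_tent hn a r⟩,
    fun w hw => Monkemeyer.isScrambling_prod_matB hn w hw⟩
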